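/- Let $\mathbb F_2$ be the field with two elements and identify $\mathbb F_2^{2n}$ with $\mathbb F_2^n\times\mathbb F_2^n$. Let $\mathcal M_{2n}$ be the Maiorana–McFarland class, i.e. the set of all Boolean functions $f_{\pi,\varphi}:\mathbb F_2^{2n}\to\mathbb F_2$, $f_{\pi,\varphi}(x,y)=\langle x,\pi(y)\rangle\oplus\varphi(y)$ for $x,y\in\mathbb F_2^n$, where $\langle x,y\rangle = x_1y_1\oplus\dots\oplus x_ny_n$, $\pi$ is a permutation of $\mathbb F_2^n$ and $\varphi:\mathbb F_2^n\to\mathbb F_2$ is arbitrary. Let $\mathcal M^{\#}_{2n}$ be its closure under EA-equivalence, i.e. the set of all functions $f\circ A\oplus h$ with $f\in\mathcal M_{2n}$, $A:\mathbb F_2^{2n}\to\mathbb F_2^{2n}$ affine and invertible, and $h:\mathbb F_2^{2n}\to\mathbb F_2$ affine. Put $$\binom{n}{k}_2=\prod_{i=0}^{k-1}\frac{2^n-2^i}{2^k-2^i},$$ $$\mu(2n)=\sum_{k=0}^{n-1}\binom{n}{k}_2^{2}\,2^{(n-k)^2}\,(2^k)!\;2^{(2n-2k+1)2^k}\prod_{i=0}^{n-k-1}\bigl(2^{n-k}-2^i\bigr)^{2^k}.$$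 Then for every $n$ $$\binom{2n}{n}_2\,|\mathcal M_{2n}|-\binom{2n}{n}_2\,\mu(2n)\;\le\;|\mathcal M^{\#}_{2n}|\;\le\;\binom{2n}{n}_2\,|\mathcal M_{2n}|.$$ Moreover $|\mathcal M^{\#}_{8}|\approx 2^{77.865}$, in the sense that $\bigl|\log_2|\mathcal M^{\#}_8|-77.865\bigr|<0.0005$. -/

import Mathlib

/-- The vector space `𝔽₂ⁿ`. -/
abbrev BVec (n : ℕ) : Type := Fin n → ZMod 2

/-- Boolean functions in `2n` variables; the variables are written as pairs `(x, y)` with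
`x, y ∈ 𝔽₂ⁿ`, that is, `𝔽₂²ⁿ = 𝔽₂ⁿ × 𝔽₂ⁿ`. -/
abbrev BFun (n : ℕ) : Type := BVec n × BVec n → ZMod 2

/-- EA-equivalence: `g = f ∘ A + h` with `A` an invertible affine map of the space of variables
and `h` an affine Boolean function. -/
def EAEquivalent {n : ℕ} (f g : BFun n) : Prop :=
  ∃ (A : (BVec n × BVec n) ≃ᵃ[ZMod 2] (BVec n × BVec n))
    (h : (BVec n × BVec n) →ᵃ[ZMod 2] ZMod 2), ∀ z, g z = f (A z) + h z

/-- The function `f_{π,φ}(x, y) = ⟨x, π(y)⟩ + φ(y)`. -/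
def mmFun {n : ℕ} (π : Equiv.Perm (BVec n)) (φ : BVec n → ZMod 2) : BFun n :=
  fun z => (∑ i, z.1 i * π z.2 i) + φ z.2

/-- The Maiorana–McFarland class in `2n` variables. -/
def mmClass (n : ℕ) : Set (BFun n) :=
  {f | ∃ (π : Equiv.Perm (BVec n)) (φ : BVec n → ZMod 2), f = mmFun π φ}

/-- The completed Maiorana–McFarland class in `2n` variables: all functions that are
EA-equivalent to a member of the Maiorana–McFarland class. -/
def completedMMClass (n : ℕ) : Set (BFun n) :=
  {g | ∃ f ∈ mmClass n, EAEquivalent f g}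

/-- The Gaussian binomial coefficient `[n choose k]₂ = ∏_{i<k} (2ⁿ - 2ⁱ) / (2ᵏ - 2ⁱ)`
(which vanishes for `k > n`, because of the factor with `i = n`). -/
def gaussBinom (n k : ℕ) : ℚ :=
  ∏ i ∈ Finset.range k, ((2 : ℚ) ^ n - 2 ^ i) / ((2 : ℚ) ^ k - 2 ^ i)

/-- The number `μ(2n)`, as a function of `n`. -/
def mmBound (n : ℕ) : ℚ :=
  ∑ k ∈ Finset.range n,
    gaussBinom n k ^ 2 * 2 ^ ((n - k) ^ 2) * (Nat.factorial (2 ^ k) : ℚ) *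
      2 ^ ((2 * (n - k) + 1) * 2 ^ k) *
      ∏ i ∈ Finset.range (n - k), ((2 : ℚ) ^ (n - k) - 2 ^ i) ^ (2 ^ k)

/-! For an `n`-dimensional subspace `U`, let `affBent U` be the set of functions that are affine on
each coset of `U`, with distinct gradients on distinct cosets. The Maiorana–McFarland class is
`affBent` of `𝔽₂ⁿ × 0` (`mmClass_eq_affBent`). Affine changes of variables move `U` transitively, so
the completed class is the union of all `affBent U` (`completedMMClass_eq_iUnion`). There are
`gaussBinom (2 * n) n` such sets, all of size `|M|` (`ncard_affBent`), and the upper bound is the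
union bound.

The lower bound is Bonferroni's inequality. For fixed `U`, the subspaces `V ≠ U` are sorted by `k =
dim (U ⊓ V) < n`. Their number is bounded by `card_finrank_inf_eq_le`, and `|affBent U ∩ affBent V|`
by a normal form that is bilinear in the directions not shared by `U` and `V`
(`exists_bilinForm_eq`). The resulting sum is at most `mmBound n`. Each unordered pair is counted
twice, so half of `μ` suffices; the estimate for `n = 4` uses this gain. -/

/-! ### Counting subspaces; Gaussian binomials. -/

open Module in
/-- The number of `k`-dimensional subspaces times the number of bases of each of them is the number
of linearly independent `k`-tuples. -/
theorem card_submodule_finrank_eq_mul {E : Type*} [AddCommGroup E] [Module (ZMod 2) E] [Finite E]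
    {k : ℕ} (hk : k ≤ finrank (ZMod 2) E) :
    Nat.card {U : Submodule (ZMod 2) E // finrank (ZMod 2) U = k} * ∏ i : Fin k, (2 ^ k - 2 ^ i.val) =
      ∏ i : Fin k, (2 ^ finrank (ZMod 2) E - 2 ^ i.val) := by
  classical
  have h := card_linearIndependent (K := ZMod 2) (V := E) hk
  rw [ZMod.card] at h
  rw [← h]
  let g : (Σ U : {U : Submodule (ZMod 2) E // finrank (ZMod 2) U = k},
      {s : Fin k → U.1 // LinearIndependent (ZMod 2) s}) →
        {s : Fin k → E // LinearIndependent (ZMod 2) s} :=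
    fun p => ⟨fun i => (p.2.1 i : E), p.2.2.map' (Submodule.subtype _) (Submodule.ker_subtype _)⟩
  have hspan (p : Σ U : {U : Submodule (ZMod 2) E // finrank (ZMod 2) U = k},
      {s : Fin k → U.1 // LinearIndependent (ZMod 2) s}) :
      Submodule.span (ZMod 2) (Set.range (g p).1) = p.1.1 := by
    apply Submodule.eq_of_le_of_finrank_eq
    · rw [Submodule.span_le]
      rintro _ ⟨i, rfl⟩
      exact (p.2.1 i).2
    · rw [p.1.2, finrank_span_eq_card (g p).2, Fintype.card_fin]
  have hg : Function.Bijective g := by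
    constructor
    · intro p p' hpp
      have hU : p.1.1 = p'.1.1 := by rw [← hspan p, ← hspan p', hpp]
      obtain ⟨⟨U, hU1⟩, ⟨s, hs⟩⟩ := p
      obtain ⟨⟨U', hU2⟩, ⟨s', hs'⟩⟩ := p'
      obtain rfl : U = U' := hU
      have : s = s' := by
        funext i
        exact Subtype.ext (congrFun (congrArg Subtype.val hpp) i)
      subst this
      rfl
    · intro s
      refine ⟨⟨⟨Submodule.span (ZMod 2) (Set.range s.1), by
          simpa using finrank_span_eq_card s.2⟩,
        ⟨fun i => ⟨s.1 i, Submodule.subset_span ⟨i, rfl⟩⟩, ?_⟩⟩, rfl⟩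
      apply LinearIndependent.of_comp (Submodule.subtype _)
      exact s.2
  rw [← Nat.card_congr (Equiv.ofBijective g hg)]
  have := Fintype.ofFinite {U : Submodule (ZMod 2) E // finrank (ZMod 2) U = k}
  rw [Nat.card_sigma]
  have h2 (U : {U : Submodule (ZMod 2) E // finrank (ZMod 2) U = k}) :
      Nat.card {s : Fin k → U.1 // LinearIndependent (ZMod 2) s} =
        ∏ i : Fin k, (2 ^ k - 2 ^ i.val) := by
    have h := card_linearIndependent (K := ZMod 2) (V := U.1) U.2.ge
    rwa [ZMod.card, U.2] at h
  simp only [h2, Finset.sum_const, Finset.card_univ, smul_eq_mul, Nat.card_eq_fintype_card]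

theorem cast_prod_two_pow_sub {k n : ℕ} (hk : k ≤ n) :
    ((∏ i : Fin k, (2 ^ n - 2 ^ i.val) : ℕ) : ℚ) =
      ∏ i ∈ Finset.range k, ((2 : ℚ) ^ n - 2 ^ i) := by
  rw [Finset.prod_range, Nat.cast_prod]
  refine Finset.prod_congr rfl fun i _ => ?_
  rw [Nat.cast_sub (Nat.pow_le_pow_right two_pos (by omega))]
  simp

theorem prod_two_pow_sub_ne_zero (k : ℕ) :
    ∏ i ∈ Finset.range k, ((2 : ℚ) ^ k - 2 ^ i) ≠ 0 := by
  rw [Finset.prod_ne_zero_iff]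
  intro i hi
  exact (sub_pos.2 (pow_lt_pow_right₀ one_lt_two (Finset.mem_range.1 hi))).ne'

open Module in
theorem card_submodule_finrank_eq {E : Type*} [AddCommGroup E] [Module (ZMod 2) E] [Finite E]
    {k : ℕ} (hk : k ≤ finrank (ZMod 2) E) :
    (Nat.card {U : Submodule (ZMod 2) E // finrank (ZMod 2) U = k} : ℚ) =
      gaussBinom (finrank (ZMod 2) E) k := by
  have h := congrArg (Nat.cast : ℕ → ℚ) (card_submodule_finrank_eq_mul hk)
  rw [Nat.cast_mul, cast_prod_two_pow_sub le_rfl, cast_prod_two_pow_sub hk] at h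
  rw [gaussBinom, Finset.prod_div_distrib, eq_div_iff (prod_two_pow_sub_ne_zero k), h]

/-- The factors with index `k + i` equal `2 ^ k * (2 ^ m - 2 ^ i)`. Completing the product in this
way gives an expression symmetric in `k` and `m`, whence `gaussBinom_symm`. -/
theorem gaussBinom_add (k m : ℕ) :
    gaussBinom (k + m) k = (∏ i ∈ Finset.range (k + m), ((2 : ℚ) ^ (k + m) - 2 ^ i)) /
      (2 ^ (k * m) * (∏ i ∈ Finset.range k, ((2 : ℚ) ^ k - 2 ^ i)) *
        ∏ i ∈ Finset.range m, ((2 : ℚ) ^ m - 2 ^ i)) := by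
  have h : ∏ i ∈ Finset.range m, ((2 : ℚ) ^ (k + m) - 2 ^ (k + i)) =
      2 ^ (k * m) * ∏ i ∈ Finset.range m, ((2 : ℚ) ^ m - 2 ^ i) := by
    rw [pow_mul]
    conv_rhs => rw [← Finset.card_range m]
    rw [← Finset.prod_const, Finset.card_range, ← Finset.prod_mul_distrib]
    exact Finset.prod_congr rfl fun i _ => by ring
  have h1 := prod_two_pow_sub_ne_zero k
  have h2 := prod_two_pow_sub_ne_zero m
  rw [Finset.prod_range_add, h, gaussBinom, Finset.prod_div_distrib]
  field_simp

theorem gaussBinom_symm {n k : ℕ} (hk : k ≤ n) : gaussBinom n (n - k) = gaussBinom n k := by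
  obtain ⟨m, rfl⟩ := Nat.exists_eq_add_of_le hk
  rw [Nat.add_sub_cancel_left, gaussBinom_add k m, Nat.add_comm k m, gaussBinom_add m k]
  ring

/-! ### Subspaces of a product and their intersection with the first factor. -/

open Module in
/-- A subspace `V` of a product is determined by `V ∩ (E₁ × 0)`, its projection to `E₂`, and a linear
map between them. -/
theorem Submodule.exists_linearMap_of_prod {E₁ E₂ : Type*} [AddCommGroup E₁] [AddCommGroup E₂]
    [Module (ZMod 2) E₁] [Module (ZMod 2) E₂] (V : Submodule (ZMod 2) (E₁ × E₂)) :
    ∃ L : V.map (LinearMap.snd (ZMod 2) E₁ E₂) →ₗ[ZMod 2]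
        E₁ ⧸ V.comap (LinearMap.inl (ZMod 2) E₁ E₂),
      ∀ z, z ∈ V ↔ ∃ h : z.2 ∈ V.map (LinearMap.snd (ZMod 2) E₁ E₂),
        (Submodule.Quotient.mk z.1 : E₁ ⧸ V.comap (LinearMap.inl (ZMod 2) E₁ E₂)) =
          L ⟨z.2, h⟩ := by
  let p : V →ₗ[ZMod 2] V.map (LinearMap.snd (ZMod 2) E₁ E₂) :=
    (LinearMap.snd (ZMod 2) E₁ E₂).submoduleMap V
  -- `L` sends `y` to the first coordinate of a linear lift `s y ∈ V`, modulo `V ∩ (E₁ × 0)`.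
  obtain ⟨s, hs⟩ := p.exists_rightInverse_of_surjective
    (LinearMap.range_eq_top.2 (LinearMap.submoduleMap_surjective _ V))
  refine ⟨(Submodule.mkQ _) ∘ₗ (LinearMap.fst (ZMod 2) E₁ E₂) ∘ₗ V.subtype ∘ₗ s, fun z => ?_⟩
  have key (h : z.2 ∈ V.map (LinearMap.snd (ZMod 2) E₁ E₂)) :
      z ∈ V ↔ z.1 - (s ⟨z.2, h⟩ : E₁ × E₂).1 ∈ V.comap (LinearMap.inl (ZMod 2) E₁ E₂) := by
    have h1 : (s ⟨z.2, h⟩ : E₁ × E₂).2 = z.2 :=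
      congrArg Subtype.val (LinearMap.congr_fun hs ⟨z.2, h⟩)
    have h2 : LinearMap.inl (ZMod 2) E₁ E₂ (z.1 - (s ⟨z.2, h⟩ : E₁ × E₂).1) =
        z - (s ⟨z.2, h⟩ : E₁ × E₂) := by
      ext <;> simp [h1]
    rw [Submodule.mem_comap, h2, Submodule.sub_mem_iff_left _ (s ⟨z.2, h⟩).2]
  constructor
  · intro hz
    have h : z.2 ∈ V.map (LinearMap.snd (ZMod 2) E₁ E₂) := ⟨z, hz, rfl⟩
    refine ⟨h, ?_⟩
    exact (Submodule.Quotient.eq _).2 ((key h).1 hz)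
  · rintro ⟨h, hL⟩
    exact (key h).2 ((Submodule.Quotient.eq _).1 hL)

open Module in
theorem Submodule.finrank_comap_inl_add_finrank_map_snd {E₁ E₂ : Type*} [AddCommGroup E₁]
    [AddCommGroup E₂] [Module (ZMod 2) E₁] [Module (ZMod 2) E₂] [Finite E₁] [Finite E₂]
    (V : Submodule (ZMod 2) (E₁ × E₂)) :
    finrank (ZMod 2) (V.comap (LinearMap.inl (ZMod 2) E₁ E₂)) +
      finrank (ZMod 2) (V.map (LinearMap.snd (ZMod 2) E₁ E₂)) = finrank (ZMod 2) V := by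
  have h := LinearMap.finrank_range_add_finrank_ker ((LinearMap.snd (ZMod 2) E₁ E₂).domRestrict V)
  rw [LinearMap.range_domRestrict] at h
  rw [← h, add_comm]
  congr 1
  refine LinearEquiv.finrank_eq (LinearEquiv.ofBijective
    (((LinearMap.inl (ZMod 2) E₁ E₂).restrict (p := V.comap (LinearMap.inl (ZMod 2) E₁ E₂)) (q := V)
      (fun x hx => hx)).codRestrict _ ?_) ⟨?_, ?_⟩)
  · intro x
    simp
  · intro x y hxy
    have := congrArg (fun t => ((t.1 : V) : E₁ × E₂).1) hxy
    exact Subtype.ext this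
  · rintro ⟨⟨⟨x, y⟩, hz⟩, hy⟩
    have hy' : y = 0 := hy
    subst hy'
    exact ⟨⟨x, hz⟩, rfl⟩

open Module in
theorem card_linearMap_two {E F : Type*} [AddCommGroup E] [Module (ZMod 2) E] [Finite E]
    [AddCommGroup F] [Module (ZMod 2) F] [Finite F] :
    Nat.card (E →ₗ[ZMod 2] F) = 2 ^ (finrank (ZMod 2) E * finrank (ZMod 2) F) := by
  rw [Module.natCard_eq_pow_finrank (K := ZMod 2), finrank_linearMap, Nat.card_zmod]

open Module in
/-- A bound on the number of `n`-dimensional subspaces that meet `F₂ⁿ × 0` in dimension `k`. -/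
theorem card_finrank_inf_eq_le {n k : ℕ} (hk : k ≤ n) :
    (Nat.card {V : Submodule (ZMod 2) (BVec n × BVec n) // finrank (ZMod 2) V = n ∧
      finrank (ZMod 2) (V.comap (LinearMap.inl (ZMod 2) (BVec n) (BVec n))) = k} : ℚ) ≤
      gaussBinom n k ^ 2 * 2 ^ ((n - k) ^ 2) := by
  classical
  have hn : finrank (ZMod 2) (BVec n) = n := by simp
  -- The triples `(W, Y, L)` with `W` the intersection, `Y` the projection and `L : Y → 𝔽₂ⁿ / W`.
  -- Source and target of `L` both have dimension `n - k`.
  let D := Σ p : {W : Submodule (ZMod 2) (BVec n) // finrank (ZMod 2) W = k} ×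
      {Y : Submodule (ZMod 2) (BVec n) // finrank (ZMod 2) Y = n - k},
    (p.2.1 →ₗ[ZMod 2] (BVec n ⧸ p.1.1))
  have hQ (W : Submodule (ZMod 2) (BVec n)) : Finite (BVec n ⧸ W) :=
    Finite.of_surjective _ (Submodule.mkQ_surjective W)
  have hfin (p : {W : Submodule (ZMod 2) (BVec n) // finrank (ZMod 2) W = k} ×
      {Y : Submodule (ZMod 2) (BVec n) // finrank (ZMod 2) Y = n - k}) :
      Finite (p.2.1 →ₗ[ZMod 2] (BVec n ⧸ p.1.1)) :=
    Finite.of_injective _ DFunLike.coe_injective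
  have hcard : (Nat.card D : ℚ) = gaussBinom n k ^ 2 * 2 ^ ((n - k) ^ 2) := by
    have h1 : Nat.card D = Nat.card ({W : Submodule (ZMod 2) (BVec n) // finrank (ZMod 2) W = k} ×
        {Y : Submodule (ZMod 2) (BVec n) // finrank (ZMod 2) Y = n - k}) * 2 ^ ((n - k) ^ 2) := by
      rw [Nat.card_sigma]
      have (p : {W : Submodule (ZMod 2) (BVec n) // finrank (ZMod 2) W = k} ×
          {Y : Submodule (ZMod 2) (BVec n) // finrank (ZMod 2) Y = n - k}) :
          Nat.card (p.2.1 →ₗ[ZMod 2] (BVec n ⧸ p.1.1)) = 2 ^ ((n - k) ^ 2) := by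
        rw [card_linearMap_two, p.2.2, Submodule.finrank_quotient, p.1.2, hn, sq]
      simp only [this, Finset.sum_const, Finset.card_univ, smul_eq_mul, Nat.card_eq_fintype_card]
    have h2 := card_submodule_finrank_eq (E := BVec n) (k := k) (by rwa [hn])
    have h3 := card_submodule_finrank_eq (E := BVec n) (k := n - k) (by rw [hn]; omega)
    rw [hn] at h2 h3
    rw [h1, Nat.card_prod]
    push_cast
    rw [h2, h3, gaussBinom_symm hk, ← sq]
  rw [← hcard]
  norm_cast
  -- `Φ` rebuilds the subspace from its triple, so any choice of triples is injective.
  let Φ : D → Set (BVec n × BVec n) := fun d =>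
    {z | ∃ h : z.2 ∈ d.1.2.1, (Submodule.Quotient.mk z.1 : BVec n ⧸ d.1.1.1) = d.2 ⟨z.2, h⟩}
  have hex (V : {V : Submodule (ZMod 2) (BVec n × BVec n) // finrank (ZMod 2) V = n ∧
      finrank (ZMod 2) (V.comap (LinearMap.inl (ZMod 2) (BVec n) (BVec n))) = k}) :
      ∃ d : D, Φ d = (V.1 : Set (BVec n × BVec n)) := by
    obtain ⟨V, hV, hVk⟩ := V
    obtain ⟨L, hL⟩ := V.exists_linearMap_of_prod
    have h := V.finrank_comap_inl_add_finrank_map_snd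
    refine ⟨⟨⟨⟨_, hVk⟩, ⟨V.map (LinearMap.snd (ZMod 2) (BVec n) (BVec n)), by omega⟩⟩, L⟩, ?_⟩
    ext z
    exact (hL z).symm
  choose g hg using hex
  refine Nat.card_le_card_of_injective g fun V V' h => ?_
  apply Subtype.ext
  apply SetLike.coe_injective
  rw [← hg V, ← hg V', h]

/-! ### Functions affine on the cosets of a subspace. -/

/-- The functions on `E` that are affine along every coset of the subspace `U`, and whose gradients
along `U` separate the cosets of `U`. -/
def affBent {E : Type*} [AddCommGroup E] [Module (ZMod 2) E] (U : Submodule (ZMod 2) E) :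
    Set (E → ZMod 2) :=
  {f | (∀ a ∈ U, ∀ b ∈ U, ∀ z, f (z + a + b) = f (z + a) + f (z + b) + f z) ∧
    ∀ z z', (∀ a ∈ U, f (z + a) + f z = f (z' + a) + f z') → z - z' ∈ U}

theorem zmod_two_two_eq_zero : (2 : ZMod 2) = 0 := rfl

/-- Adding `h` shifts the gradients on all cosets by the same linear form, so they remain distinct.
-/
theorem affBent_affine_comp {E E' : Type*} [AddCommGroup E] [Module (ZMod 2) E] [AddCommGroup E']
    [Module (ZMod 2) E'] (A : E ≃ᵃ[ZMod 2] E') (h : E →ᵃ[ZMod 2] ZMod 2)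
    {U : Submodule (ZMod 2) E'} {f : E' → ZMod 2} (hf : f ∈ affBent U) :
    (fun z => f (A z) + h z) ∈ affBent (U.comap (A.linear : E →ₗ[ZMod 2] E')) := by
  have hA (z a : E) : A (z + a) = A z + A.linear a := by
    rw [add_comm z a, ← vadd_eq_add, A.map_vadd, vadd_eq_add, add_comm]
  have hh (z a : E) : h (z + a) = h z + h.linear a := by
    rw [add_comm z a, ← vadd_eq_add, h.map_vadd, vadd_eq_add, add_comm]
  constructor
  · intro a ha b hb z
    have := hf.1 _ ha _ hb (A z)
    simp only [LinearEquiv.coe_coe] at this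
    simp only [hA, hh, this]
    linear_combination (-h z) * zmod_two_two_eq_zero
  · intro z z' H
    have := hf.2 (A z) (A z') fun b hb => by
      have := H (A.linear.symm b) (by simpa using hb)
      simp only [hA, hh, LinearEquiv.apply_symm_apply] at this
      linear_combination this + (h z' - h z) * zmod_two_two_eq_zero
    rw [Submodule.mem_comap, map_sub]
    have h2 := hA z' (z - z')
    rw [add_sub_cancel] at h2
    rw [h2, add_sub_cancel_left, map_sub] at this
    exact this

theorem affBent_comp_linearEquiv {E E' : Type*} [AddCommGroup E] [Module (ZMod 2) E]
    [AddCommGroup E'] [Module (ZMod 2) E'] (e : E ≃ₗ[ZMod 2] E')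
    {U : Submodule (ZMod 2) E'} {f : E' → ZMod 2} (hf : f ∈ affBent U) :
    f ∘ e ∈ affBent (U.comap (e : E →ₗ[ZMod 2] E')) := by
  rw [show f ∘ e = fun z => f (e.toAffineEquiv z) + (0 : E →ᵃ[ZMod 2] ZMod 2) z from
    funext fun z => (add_zero (f (e z))).symm]
  exact affBent_affine_comp e.toAffineEquiv 0 hf

theorem exists_dotProduct_of_map_add {k : ℕ} (p : BVec k → ZMod 2)
    (hp : ∀ x y, p (x + y) = p x + p y) : ∃ a : BVec k, ∀ x, p x = x ⬝ᵥ a := by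
  let P : BVec k →ₗ[ZMod 2] ZMod 2 := (AddMonoidHom.mk' p hp).toZModLinearMap 2
  refine ⟨fun i => P fun j => if i = j then 1 else 0, fun x => ?_⟩
  exact P.pi_apply_eq_sum_univ x

theorem exists_mulVec_of_map_add {k : ℕ} (B : BVec k → BVec k → ZMod 2)
    (h₁ : ∀ x x' y, B (x + x') y = B x y + B x' y)
    (h₂ : ∀ x y y', B x (y + y') = B x y + B x y') :
    ∃ M : Matrix (Fin k) (Fin k) (ZMod 2), ∀ x y, B x y = x ⬝ᵥ M.mulVec y := by
  choose a ha using fun y => exists_dotProduct_of_map_add (fun x => B x y) (fun x x' => h₁ x x' y)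
  have hadd (y y' : BVec k) : a (y + y') = a y + a y' := by
    refine dotProduct_eq _ _ fun x => ?_
    rw [dotProduct_comm, ← ha, h₂, add_dotProduct, ha, ha, dotProduct_comm, dotProduct_comm x]
  choose r hr using fun i => exists_dotProduct_of_map_add (fun y => a y i)
    (fun y y' => congrFun (hadd y y') i)
  refine ⟨Matrix.of r, fun x y => ?_⟩
  rw [ha]
  congr 1
  funext i
  rw [hr, dotProduct_comm]
  rfl

theorem dotProduct_eq_iff_forall {k : ℕ} {a b : BVec k} :
    (∀ x : BVec k, x ⬝ᵥ a = x ⬝ᵥ b) ↔ a = b := by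
  refine ⟨fun h => dotProduct_eq _ _ fun x => ?_, fun h x => by rw [h]⟩
  rw [dotProduct_comm, h, dotProduct_comm]

/-- The gradient of `f_{π,φ}` in the `x`-directions is `π y`, so separation of cosets means
injectivity of `π`. Conversely `φ` is recovered as the restriction to `x = 0`. -/
theorem mmClass_eq_affBent (n : ℕ) :
    mmClass n = affBent (LinearMap.ker (LinearMap.snd (ZMod 2) (BVec n) (BVec n))) := by
  ext f
  constructor
  · rintro ⟨π, φ, rfl⟩
    have hval (z : BVec n × BVec n) : mmFun π φ z = z.1 ⬝ᵥ π z.2 + φ z.2 := rfl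
    constructor
    · rintro ⟨a, _⟩ rfl ⟨b, _⟩ rfl ⟨x, y⟩
      simp only [hval, Prod.mk_add_mk, add_zero, add_dotProduct]
      linear_combination (-(x ⬝ᵥ π y) - φ y) * zmod_two_two_eq_zero
    · rintro ⟨x, y⟩ ⟨x', y'⟩ H
      have : π y = π y' := by
        refine dotProduct_eq_iff_forall.1 fun a => ?_
        have := H (a, 0) rfl
        simp only [hval, Prod.mk_add_mk, add_zero, add_dotProduct] at this
        linear_combination this +
          (x' ⬝ᵥ π y' + φ y' - x ⬝ᵥ π y - φ y) * zmod_two_two_eq_zero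
      exact sub_eq_zero.2 (π.injective this)
  · rintro ⟨h₁, h₂⟩
    have hsum (x x' y : BVec n) : f (x + x', y) = f (x, y) + f (x', y) + f (0, y) := by
      simpa using h₁ (x, 0) rfl (x', 0) rfl (0, y)
    choose σ hσ using fun y => exists_dotProduct_of_map_add (fun x => f (x, y) + f (0, y))
      (fun x x' => by
        rw [hsum]
        ring)
    have hinj : Function.Injective σ := by
      intro y y' hyy
      refine sub_eq_zero.1 (h₂ (0, y) (0, y') ?_)
      rintro ⟨a, _⟩ rfl
      have h1 := hσ y a
      have h2 := hσ y' a
      rw [hyy] at h1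
      simpa using h1.trans h2.symm
    refine ⟨Equiv.ofBijective σ (Finite.injective_iff_bijective.1 hinj), fun y => f (0, y), ?_⟩
    funext ⟨x, y⟩
    have h1 : f (x, y) + f (0, y) = x ⬝ᵥ σ y := hσ y x
    change f (x, y) = x ⬝ᵥ σ y + f (0, y)
    linear_combination h1 - f (0, y) * zmod_two_two_eq_zero

/-! ### Coordinates adapted to one or two subspaces. -/

open Module in
theorem exists_linearEquiv_comap_eq_ker_snd {E : Type*} [AddCommGroup E] [Module (ZMod 2) E]
    [Finite E] {n : ℕ} (hE : finrank (ZMod 2) E = 2 * n) (U : Submodule (ZMod 2) E)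
    (hU : finrank (ZMod 2) U = n) :
    ∃ e : (BVec n × BVec n) ≃ₗ[ZMod 2] E,
      U.comap (e : (BVec n × BVec n) →ₗ[ZMod 2] E) =
        LinearMap.ker (LinearMap.snd (ZMod 2) (BVec n) (BVec n)) := by
  obtain ⟨C, hC⟩ := U.exists_isCompl
  have hCn : finrank (ZMod 2) C = n := by
    have := Submodule.finrank_add_eq_of_isCompl hC
    omega
  let eU : BVec n ≃ₗ[ZMod 2] U := LinearEquiv.ofFinrankEq _ _ (by simp [hU])
  let eC : BVec n ≃ₗ[ZMod 2] C := LinearEquiv.ofFinrankEq _ _ (by simp [hCn])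
  refine ⟨(eU.prodCongr eC).trans (Submodule.prodEquivOfIsCompl U C hC), ?_⟩
  ext ⟨x, y⟩
  have : ((eU x : E) + (eC y : E) ∈ U) ↔ y = 0 := by
    rw [Submodule.add_mem_iff_right _ (eU x).2]
    constructor
    · intro h
      have := Submodule.disjoint_def.1 hC.disjoint _ h (eC y).2
      simpa using this
    · rintro rfl
      simp
  simpa using this

open Module in
theorem Submodule.exists_relative_compl {E : Type*} [AddCommGroup E] [Module (ZMod 2) E]
    [Finite E] {W U : Submodule (ZMod 2) E} (h : W ≤ U) :
    ∃ U' ≤ U, W ⊓ U' = ⊥ ∧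
      finrank (ZMod 2) W + finrank (ZMod 2) U' = finrank (ZMod 2) U := by
  obtain ⟨C, hC⟩ := W.exists_isCompl
  have h1 : W ⊓ (C ⊓ U) = ⊥ := by rw [← inf_assoc, hC.inf_eq_bot, bot_inf_eq]
  have h2 : W ⊔ (C ⊓ U) = U := by rw [← sup_inf_assoc_of_le C h, hC.sup_eq_top, top_inf_eq]
  refine ⟨C ⊓ U, inf_le_right, h1, ?_⟩
  have := Submodule.finrank_sup_add_finrank_inf_eq W (C ⊓ U)
  rw [h1, h2, finrank_bot] at this
  omega

open Module in
/-- Simultaneous coordinates for two `n`-dimensional subspaces of a `2n`-dimensional space. -/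
theorem exists_linearEquiv_pair {E : Type*} [AddCommGroup E] [Module (ZMod 2) E] [Finite E]
    {k m : ℕ} (hE : finrank (ZMod 2) E = 2 * (k + m)) {U V : Submodule (ZMod 2) E}
    (hU : finrank (ZMod 2) U = k + m) (hV : finrank (ZMod 2) V = k + m)
    (hUV : finrank (ZMod 2) (U ⊓ V : Submodule (ZMod 2) E) = k) :
    ∃ e : ((BVec k × BVec m) × (BVec k × BVec m)) ≃ₗ[ZMod 2] E,
      (∀ z, e z ∈ U ↔ z.2 = 0) ∧ ∀ z, e z ∈ V ↔ z.1.2 = 0 ∧ z.2.1 = 0 := by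
  -- `E = (U ⊓ V) ⊕ U' ⊕ C ⊕ V'` with dimensions `k, m, k, m`, where `U = (U ⊓ V) ⊕ U'` and `V = (U
  -- ⊓ V) ⊕ V'`.
  obtain ⟨U', hU'U, hU', hUd⟩ := Submodule.exists_relative_compl (inf_le_left : U ⊓ V ≤ U)
  obtain ⟨V', hV'V, hV', hVd⟩ := Submodule.exists_relative_compl (inf_le_right : U ⊓ V ≤ V)
  obtain ⟨C, hC⟩ := (U ⊔ V).exists_isCompl
  have hCd := Submodule.finrank_add_eq_of_isCompl hC
  have hs := Submodule.finrank_sup_add_finrank_inf_eq U V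
  let eW : BVec k ≃ₗ[ZMod 2] (U ⊓ V : Submodule (ZMod 2) E) :=
    LinearEquiv.ofFinrankEq _ _ (by simp [hUV])
  let eU : BVec m ≃ₗ[ZMod 2] U' := LinearEquiv.ofFinrankEq _ _ (by simp; omega)
  let eV : BVec m ≃ₗ[ZMod 2] V' := LinearEquiv.ofFinrankEq _ _ (by simp; omega)
  let eC : BVec k ≃ₗ[ZMod 2] C := LinearEquiv.ofFinrankEq _ _ (by simp; omega)
  let g : ((BVec k × BVec m) × (BVec k × BVec m)) →ₗ[ZMod 2] E :=
    (((Submodule.subtype _).comp eW.toLinearMap).coprod ((Submodule.subtype _).comp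
      eU.toLinearMap)).coprod (((Submodule.subtype _).comp eC.toLinearMap).coprod
        ((Submodule.subtype _).comp eV.toLinearMap))
  have hg (z) : g z = (eW z.1.1 : E) + eU z.1.2 + (eC z.2.1 + eV z.2.2) := rfl
  have hgU (z) : g z ∈ U ↔ z.2 = 0 := by
    rw [hg, Submodule.add_mem_iff_right _ (add_mem (eW z.1.1).2.1 (hU'U (eU z.1.2).2))]
    constructor
    · intro h
      have hc : (eC z.2.1 : E) ∈ U ⊔ V := by
        rw [← Submodule.add_mem_iff_left _
          ((le_sup_right : V ≤ U ⊔ V) (hV'V (eV z.2.2).2))]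
        exact (le_sup_left : U ≤ U ⊔ V) h
      have hc0 := Submodule.disjoint_def.1 hC.disjoint _ hc (eC z.2.1).2
      rw [hc0, zero_add] at h
      have hv : (eV z.2.2 : E) ∈ U ⊓ V ⊓ V' := ⟨⟨h, hV'V (eV z.2.2).2⟩, (eV z.2.2).2⟩
      rw [hV'] at hv
      exact Prod.ext (by simpa using hc0) (by simpa using hv)
    · intro h
      simp [h]
  have hgV (z) : g z ∈ V ↔ z.1.2 = 0 ∧ z.2.1 = 0 := by
    rw [hg, show (eW z.1.1 : E) + eU z.1.2 + (eC z.2.1 + eV z.2.2) =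
      (eW z.1.1 + eV z.2.2) + (eU z.1.2 + eC z.2.1) by abel,
      Submodule.add_mem_iff_right _ (add_mem (eW z.1.1).2.2 (hV'V (eV z.2.2).2))]
    constructor
    · intro h
      have hc : (eC z.2.1 : E) ∈ U ⊔ V := by
        rw [← Submodule.add_mem_iff_right _
          ((le_sup_left : U ≤ U ⊔ V) (hU'U (eU z.1.2).2))]
        exact (le_sup_right : V ≤ U ⊔ V) h
      have hc0 := Submodule.disjoint_def.1 hC.disjoint _ hc (eC z.2.1).2
      rw [hc0, add_zero] at h
      have hu : (eU z.1.2 : E) ∈ U ⊓ V ⊓ U' := ⟨⟨hU'U (eU z.1.2).2, h⟩, (eU z.1.2).2⟩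
      rw [hU'] at hu
      exact ⟨by simpa using hu, by simpa using hc0⟩
    · rintro ⟨h1, h2⟩
      simp [h1, h2]
  have hinj : Function.Injective g := by
    refine (injective_iff_map_eq_zero g).2 fun z hz => ?_
    have h1 : z.2 = 0 := (hgU z).1 (by rw [hz]; exact zero_mem _)
    have h2 : z.1.2 = 0 := ((hgV z).1 (by rw [hz]; exact zero_mem _)).1
    have h3 : z.1.1 = 0 := by
      rw [hg, h1, h2] at hz
      simpa using hz
    exact Prod.ext (Prod.ext h3 h2) h1
  refine ⟨LinearMap.linearEquivOfInjective g hinj ?_, hgU, hgV⟩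
  simp [hE]
  omega

/-! ### Functions attached to two subspaces at once. -/

/-- The function on `(F₂ᵏ × F₂ᵐ)²` that is bilinear along the last coordinates. -/
def bilinForm {k m : ℕ} (d : Equiv.Perm (BVec k) × (BVec k →
    Matrix.GeneralLinearGroup (Fin m) (ZMod 2) × BVec m × BVec m × ZMod 2)) :
    (BVec k × BVec m) × (BVec k × BVec m) → ZMod 2 :=
  fun z => z.1.1 ⬝ᵥ d.1 z.2.1 + z.1.2 ⬝ᵥ ((d.2 z.2.1).1.1).mulVec z.2.2 +
    z.1.2 ⬝ᵥ (d.2 z.2.1).2.1 + z.2.2 ⬝ᵥ (d.2 z.2.1).2.2.1 + (d.2 z.2.1).2.2.2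

/-- For fixed `c`, the function is affine jointly in `(w, u)` and jointly in `(w, v)`, so the only
mixed term is bilinear in `u` and `v`. -/
theorem exists_bilinForm_eq {k m : ℕ} {U V : Submodule (ZMod 2) ((BVec k × BVec m) ×
    (BVec k × BVec m))} (hU : ∀ z, z ∈ U ↔ z.2 = 0) (hV : ∀ z, z ∈ V ↔ z.1.2 = 0 ∧ z.2.1 = 0)
    {f : (BVec k × BVec m) × (BVec k × BVec m) → ZMod 2} (hfU : f ∈ affBent U)
    (hfV : f ∈ affBent V) : ∃ d, bilinForm d = f := by
  have h2 := zmod_two_two_eq_zero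
  have hUsum (w w' : BVec k) (u u' : BVec m) (y : BVec k × BVec m) :
      f ((w + w', u + u'), y) = f ((w, u), y) + f ((w', u'), y) + f ((0, 0), y) := by
    simpa using hfU.1 ((w, u), 0) ((hU _).2 rfl) ((w', u'), 0) ((hU _).2 rfl) ((0, 0), y)
  have hVsum (w w' : BVec k) (u : BVec m) (c : BVec k) (v v' : BVec m) :
      f ((w + w', u), c, v + v') = f ((w, u), c, v) + f ((w', u), c, v') + f ((0, u), c, 0) := by
    simpa using hfV.1 ((w, 0), 0, v) ((hV _).2 ⟨rfl, rfl⟩) ((w', 0), 0, v')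
      ((hV _).2 ⟨rfl, rfl⟩) ((0, u), c, 0)
  choose σ hσ using fun c => exists_dotProduct_of_map_add
    (fun w => f ((w, 0), c, 0) + f ((0, 0), c, 0)) (fun w w' => by
      have := hUsum w w' 0 0 (c, 0)
      rw [add_zero] at this
      linear_combination this)
  choose α hα using fun c => exists_dotProduct_of_map_add
    (fun u => f ((0, u), c, 0) + f ((0, 0), c, 0)) (fun u u' => by
      have := hUsum 0 0 u u' (c, 0)
      rw [add_zero] at this
      linear_combination this)
  choose β hβ using fun c => exists_dotProduct_of_map_add
    (fun v => f ((0, 0), c, v) + f ((0, 0), c, 0)) (fun v v' => by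
      have := hVsum 0 0 0 c v v'
      rw [add_zero] at this
      linear_combination this)
  -- The mixed second difference in `u` and `v`.
  choose B hB using fun c => exists_mulVec_of_map_add
    (fun u v => f ((0, u), c, v) + f ((0, u), c, 0) + f ((0, 0), c, v) + f ((0, 0), c, 0))
    (fun u u' v => by
      have h1 := hUsum 0 0 u u' (c, v)
      have h3 := hUsum 0 0 u u' (c, 0)
      rw [add_zero] at h1 h3
      linear_combination h1 + h3)
    (fun u v v' => by
      have h1 := hVsum 0 0 u c v v'
      have h3 := hVsum 0 0 0 c v v'
      rw [add_zero] at h1 h3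
      linear_combination h1 + h3)
  have hf (w u c v) : f ((w, u), c, v) = w ⬝ᵥ σ c + u ⬝ᵥ (B c).mulVec v + u ⬝ᵥ α c + v ⬝ᵥ β c +
      f ((0, 0), c, 0) := by
    have h3 := hUsum w 0 0 u (c, v)
    have h4 := hVsum w 0 0 c 0 v
    simp only [add_zero, zero_add] at h3 h4
    rw [← hσ, ← hα, ← hβ, ← hB, h3, h4]
    linear_combination (-2 * f ((0, 0), c, 0) - f ((0, u), c, 0)) * h2
  -- This map is the gradient along `U`. Its injectivity for fixed `c` makes `B c` invertible; by
  -- finiteness it is also surjective, and so is `σ`.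
  have hinj : Function.Injective fun y : BVec k × BVec m => (σ y.1, (B y.1).mulVec y.2 + α y.1) := by
    rintro ⟨c, v⟩ ⟨c', v'⟩ h
    rw [Prod.mk.injEq] at h
    dsimp only at h
    have := hfU.2 ((0, 0), c, v) ((0, 0), c', v') ?_
    · rw [hU] at this
      exact sub_eq_zero.1 this
    rintro ⟨⟨w, u⟩, y⟩ hy
    obtain rfl : y = 0 := (hU _).1 hy
    have h3 := congrArg (fun t => u ⬝ᵥ t) h.2
    simp only [dotProduct_add] at h3
    simp only [Prod.mk_add_mk, zero_add, add_zero]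
    rw [hf w u c v, hf w u c' v', hf 0 0 c v, hf 0 0 c' v']
    simp only [zero_dotProduct, h.1]
    linear_combination h3 + (v ⬝ᵥ β c + f ((0, 0), c, 0) - v' ⬝ᵥ β c' - f ((0, 0), c', 0)) * h2
  have hB' (c) : IsUnit (B c) := by
    rw [← Matrix.mulVec_injective_iff_isUnit]
    intro v v' h
    have := hinj (a₁ := (c, v)) (a₂ := (c, v')) (by simp only [h])
    exact (Prod.mk.inj this).2
  have hσ' : Function.Bijective σ := by
    refine Finite.injective_iff_bijective.1 (Finite.injective_iff_surjective.2 fun x => ?_)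
    obtain ⟨y, hy⟩ := Finite.injective_iff_surjective.1 hinj (x, 0)
    exact ⟨y.1, (Prod.mk.inj hy).1⟩
  refine ⟨⟨Equiv.ofBijective σ hσ', fun c => ⟨(hB' c).unit, α c, β c, f ((0, 0), c, 0)⟩⟩, ?_⟩
  funext ⟨⟨w, u⟩, c, v⟩
  exact (hf w u c v).symm

-- In adapted coordinates the intersection lies in the range of `bilinForm`, so it suffices to count
-- parameters: a permutation of `𝔽₂ᵏ` and, for each of its `2 ^ k` points, an invertible matrix, two
-- vectors and a constant.
open Module in
theorem ncard_affBent_inter_le {E : Type*} [AddCommGroup E] [Module (ZMod 2) E] [Finite E]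
    {k m : ℕ} (hE : finrank (ZMod 2) E = 2 * (k + m)) {U V : Submodule (ZMod 2) E}
    (hU : finrank (ZMod 2) U = k + m) (hV : finrank (ZMod 2) V = k + m)
    (hUV : finrank (ZMod 2) (U ⊓ V : Submodule (ZMod 2) E) = k) :
    (affBent U ∩ affBent V).ncard ≤ (2 ^ k).factorial *
      ((∏ i : Fin m, (2 ^ m - 2 ^ i.val)) * (2 ^ m * (2 ^ m * 2))) ^ 2 ^ k := by
  classical
  obtain ⟨e, heU, heV⟩ := exists_linearEquiv_pair hE hU hV hUV
  have hcard : Nat.card (Equiv.Perm (BVec k) × (BVec k →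
      Matrix.GeneralLinearGroup (Fin m) (ZMod 2) × BVec m × BVec m × ZMod 2)) =
      (2 ^ k).factorial *
        ((∏ i : Fin m, (2 ^ m - 2 ^ i.val)) * (2 ^ m * (2 ^ m * 2))) ^ 2 ^ k := by
    rw [Nat.card_prod, Nat.card_perm, Nat.card_fun (α := BVec k), Nat.card_prod,
      Matrix.card_GL_field]
    simp
  rw [← hcard, ← Set.ncard_univ, ← Set.ncard_image_of_injective (affBent U ∩ affBent V)
    (f := fun f => f ∘ e) e.surjective.injective_comp_right]
  refine (Set.ncard_le_ncard ?_ (Set.toFinite _)).trans (Set.ncard_image_le (f := bilinForm)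
    (Set.toFinite _))
  rintro _ ⟨f, hf, rfl⟩
  obtain ⟨d, hd⟩ := exists_bilinForm_eq (fun z => heU z) (fun z => heV z)
    (affBent_comp_linearEquiv e hf.1) (affBent_comp_linearEquiv e hf.2)
  exact ⟨d, trivial, hd⟩

/-! ### The completed class as a union of equinumerous sets. -/

theorem image_comp_affBent {E E' : Type*} [AddCommGroup E] [Module (ZMod 2) E]
    [AddCommGroup E'] [Module (ZMod 2) E'] (e : E ≃ₗ[ZMod 2] E') (U : Submodule (ZMod 2) E') :
    (fun f : E' → ZMod 2 => f ∘ e) '' affBent U =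
      affBent (U.comap (e : E →ₗ[ZMod 2] E')) := by
  apply Set.Subset.antisymm
  · rintro _ ⟨f, hf, rfl⟩
    exact affBent_comp_linearEquiv e hf
  · intro f hf
    refine ⟨f ∘ e.symm, ?_, ?_⟩
    · have h := affBent_comp_linearEquiv e.symm hf
      rwa [← Submodule.comap_comp, LinearEquiv.comp_coe, LinearEquiv.symm_trans_self,
        LinearEquiv.refl_toLinearMap, Submodule.comap_id] at h
    · funext z
      exact congrArg f (e.symm_apply_apply z)

open Module in
theorem ncard_affBent {n : ℕ} {U : Submodule (ZMod 2) (BVec n × BVec n)}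
    (hU : finrank (ZMod 2) U = n) : (affBent U).ncard = (mmClass n).ncard := by
  obtain ⟨e, he⟩ := exists_linearEquiv_comap_eq_ker_snd (n := n) (by simp; omega) U hU
  rw [mmClass_eq_affBent, ← he, ← image_comp_affBent,
    Set.ncard_image_of_injective _ e.surjective.injective_comp_right]

open Module in
theorem finrank_comap_linearEquiv {E E' : Type*} [AddCommGroup E] [Module (ZMod 2) E]
    [AddCommGroup E'] [Module (ZMod 2) E'] (e : E ≃ₗ[ZMod 2] E') (U : Submodule (ZMod 2) E') :
    finrank (ZMod 2) (U.comap (e : E →ₗ[ZMod 2] E')) = finrank (ZMod 2) U := by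
  rw [← e.finrank_map_eq, Submodule.map_comap_eq_of_surjective e.surjective]

open Module in
theorem finrank_ker_snd (n : ℕ) :
    finrank (ZMod 2) (LinearMap.ker (LinearMap.snd (ZMod 2) (BVec n) (BVec n))) = n := by
  rw [LinearMap.ker_snd, LinearMap.finrank_range_of_inj LinearMap.inl_injective]
  simp

-- The subspace attached to `f ∘ A + h` is the preimage of `𝔽₂ⁿ × 0` under the linear part of `A`.
-- Conversely, a linear change of variables carries any `U` to `𝔽₂ⁿ × 0`.
open Module in
theorem completedMMClass_eq_iUnion (n : ℕ) :
    completedMMClass n =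
      ⋃ U : {U : Submodule (ZMod 2) (BVec n × BVec n) // finrank (ZMod 2) U = n}, affBent U.1 := by
  ext g
  rw [Set.mem_iUnion]
  constructor
  · rintro ⟨f, hf, A, h, hg⟩
    rw [mmClass_eq_affBent] at hf
    refine ⟨⟨_, ?_⟩, (funext hg : g = _) ▸ affBent_affine_comp A h hf⟩
    exact (finrank_comap_linearEquiv A.linear _).trans (finrank_ker_snd n)
  · rintro ⟨⟨U, hU⟩, hg⟩
    obtain ⟨e, he⟩ := exists_linearEquiv_comap_eq_ker_snd (n := n) (by simp; omega) U hU
    refine ⟨g ∘ e, ?_, e.symm.toAffineEquiv, 0, fun z => ?_⟩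
    · rw [mmClass_eq_affBent, ← he]
      exact affBent_comp_linearEquiv e hg
    · simp

/-! ### The sum of the pairwise intersections. -/

open Module in
theorem card_finrank_inf_eq_le_of_submodule {n k : ℕ} (hk : k ≤ n)
    {U : Submodule (ZMod 2) (BVec n × BVec n)} (hU : finrank (ZMod 2) U = n) :
    (Nat.card {V : Submodule (ZMod 2) (BVec n × BVec n) // finrank (ZMod 2) V = n ∧
      finrank (ZMod 2) (U ⊓ V : Submodule (ZMod 2) (BVec n × BVec n)) = k} : ℚ) ≤
      gaussBinom n k ^ 2 * 2 ^ ((n - k) ^ 2) := by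
  obtain ⟨e, he⟩ := exists_linearEquiv_comap_eq_ker_snd (n := n) (by simp; omega) U hU
  refine le_trans ?_ (card_finrank_inf_eq_le hk)
  norm_cast
  have h (V : Submodule (ZMod 2) (BVec n × BVec n)) :
      finrank (ZMod 2) ((V.comap (e : _ →ₗ[ZMod 2] _)).comap
        (LinearMap.inl (ZMod 2) (BVec n) (BVec n))) =
      finrank (ZMod 2) (U ⊓ V : Submodule (ZMod 2) (BVec n × BVec n)) := by
    rw [← finrank_comap_linearEquiv e (U ⊓ V), Submodule.comap_inf, he, LinearMap.ker_snd,
      ← Submodule.map_comap_eq]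
    exact LinearEquiv.finrank_eq (Submodule.equivMapOfInjective _ LinearMap.inl_injective _)
  refine Nat.card_le_card_of_injective
    (fun V => ⟨V.1.comap (e : _ →ₗ[ZMod 2] _), by
      rw [finrank_comap_linearEquiv, h]
      exact V.2⟩) fun V V' hVV => ?_
  apply Subtype.ext
  exact Submodule.comap_injective_of_surjective e.surjective (congrArg Subtype.val hVV)

open Module in
theorem ncard_affBent_inter_le_rat {n k : ℕ} (hk : k ≤ n)
    {U V : Submodule (ZMod 2) (BVec n × BVec n)} (hU : finrank (ZMod 2) U = n)
    (hV : finrank (ZMod 2) V = n)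
    (hUV : finrank (ZMod 2) (U ⊓ V : Submodule (ZMod 2) (BVec n × BVec n)) = k) :
    ((affBent U ∩ affBent V).ncard : ℚ) ≤ (Nat.factorial (2 ^ k) : ℚ) *
      2 ^ ((2 * (n - k) + 1) * 2 ^ k) *
      ∏ i ∈ Finset.range (n - k), ((2 : ℚ) ^ (n - k) - 2 ^ i) ^ (2 ^ k) := by
  obtain ⟨m, rfl⟩ := Nat.exists_eq_add_of_le hk
  have h := ncard_affBent_inter_le (k := k) (m := m) (by simp; omega) hU hV hUV
  refine (Nat.cast_le.2 h).trans_eq ?_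
  rw [Nat.add_sub_cancel_left, Finset.prod_pow, ← cast_prod_two_pow_sub le_rfl]
  push_cast
  rw [mul_pow, pow_mul (2 : ℚ) (2 * m + 1)]
  ring

-- Grouping by `k = dim (U ⊓ V)` bounds each group by one summand of `mmBound`; `k = n` would force
-- `V = U`.
open Module in
theorem sum_ncard_affBent_inter_le {n : ℕ}
    [Fintype {U : Submodule (ZMod 2) (BVec n × BVec n) // finrank (ZMod 2) U = n}]
    [DecidableEq {U : Submodule (ZMod 2) (BVec n × BVec n) // finrank (ZMod 2) U = n}]
    (U : {U : Submodule (ZMod 2) (BVec n × BVec n) // finrank (ZMod 2) U = n}) :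
    ∑ V ∈ Finset.univ.erase U, ((affBent U.1 ∩ affBent V.1).ncard : ℚ) ≤ mmBound n := by
  have hmaps : ∀ V ∈ Finset.univ.erase U, finrank (ZMod 2)
      (U.1 ⊓ V.1 : Submodule (ZMod 2) (BVec n × BVec n)) ∈ Finset.range n := by
    intro V hV
    rw [Finset.mem_range]
    by_contra! hlt
    refine (Finset.mem_erase.1 hV).1 (Subtype.ext ?_)
    have h1 := Submodule.eq_of_le_of_finrank_le (inf_le_left : U.1 ⊓ V.1 ≤ U.1) (by rwa [U.2])
    have h2 := Submodule.eq_of_le_of_finrank_le (inf_le_right : U.1 ⊓ V.1 ≤ V.1) (by rwa [V.2])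
    rw [← h2, h1]
  rw [← Finset.sum_fiberwise_of_maps_to hmaps]
  refine Finset.sum_le_sum fun k hk => ?_
  have hk' : k ≤ n := (Finset.mem_range.1 hk).le
  set c := (Nat.factorial (2 ^ k) : ℚ) * 2 ^ ((2 * (n - k) + 1) * 2 ^ k) *
      ∏ i ∈ Finset.range (n - k), ((2 : ℚ) ^ (n - k) - 2 ^ i) ^ (2 ^ k) with hc
  have hc0 : 0 ≤ c := by
    have : 0 ≤ ∏ i ∈ Finset.range (n - k), ((2 : ℚ) ^ (n - k) - 2 ^ i) ^ (2 ^ k) :=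
      Finset.prod_nonneg fun i hi => pow_nonneg (sub_nonneg.2
        (pow_le_pow_right₀ one_le_two (Finset.mem_range.1 hi).le)) _
    positivity
  refine (Finset.sum_le_card_nsmul _ _ c fun V hV => ?_).trans ?_
  · exact ncard_affBent_inter_le_rat hk' U.2 V.2 (Finset.mem_filter.1 hV).2
  rw [nsmul_eq_mul, mul_assoc, mul_assoc, ← mul_assoc (Nat.factorial (2 ^ k) : ℚ), ← hc]
  refine mul_le_mul_of_nonneg_right (le_trans ?_ (card_finrank_inf_eq_le_of_submodule hk' U.2)) hc0
  norm_cast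
  rw [← Fintype.card_coe, ← Nat.card_eq_fintype_card]
  refine Nat.card_le_card_of_injective
    (fun V => ⟨V.1.1, V.1.2, (Finset.mem_filter.1 V.2).2⟩) fun V V' h => ?_
  exact Subtype.ext (Subtype.ext (Subtype.mk.inj h))

/-! ### Bonferroni's inequality and the two bounds. -/

/-- The second Bonferroni inequality for the cardinality of a union. -/
theorem two_mul_sum_ncard_le {ι X : Type*} [Fintype ι] [DecidableEq ι] [Finite X]
    (S : ι → Set X) :
    2 * ∑ i, (S i).ncard ≤
      2 * (⋃ i, S i).ncard + ∑ i, ∑ j ∈ Finset.univ.erase i, (S i ∩ S j).ncard := by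
  classical
  have := Fintype.ofFinite X
  have hn (T : Set X) : T.ncard = ∑ x, T.indicator (1 : X → ℕ) x := by
    simp only [Set.indicator_apply, Pi.one_apply]
    rw [Set.ncard_eq_toFinset_card', ← Finset.card_filter]
    congr 1
    ext x
    simp
  simp only [hn]
  have h1 : ∑ i, ∑ x, (S i).indicator (1 : X → ℕ) x =
      ∑ x, (Finset.univ.filter (x ∈ S ·)).card := by
    rw [Finset.sum_comm]
    simp only [Finset.card_filter, Set.indicator_apply, Pi.one_apply]
  have h2 (i x) : ∑ j ∈ Finset.univ.erase i, (S i ∩ S j).indicator (1 : X → ℕ) x =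
      if x ∈ S i then (Finset.univ.filter (x ∈ S ·)).card - 1 else 0 := by
    split_ifs with hx
    · simp only [Set.indicator_apply, Pi.one_apply, Set.mem_inter_iff, hx, true_and]
      rw [← Finset.card_filter, Finset.filter_erase, Finset.card_erase_of_mem (by simpa using hx)]
    · simp [hx]
  have h3 : ∑ i, ∑ j ∈ Finset.univ.erase i, ∑ x, (S i ∩ S j).indicator (1 : X → ℕ) x =
      ∑ x, (Finset.univ.filter (x ∈ S ·)).card * ((Finset.univ.filter (x ∈ S ·)).card - 1) := by
    calc _ = ∑ i, ∑ x, if x ∈ S i then (Finset.univ.filter (x ∈ S ·)).card - 1 else 0 := by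
          refine Finset.sum_congr rfl fun i _ => ?_
          rw [Finset.sum_comm]
          exact Finset.sum_congr rfl fun x _ => h2 i x
      _ = _ := by
          rw [Finset.sum_comm]
          refine Finset.sum_congr rfl fun x _ => ?_
          rw [← Finset.sum_filter, Finset.sum_const, smul_eq_mul]
  rw [h1, h3, Finset.mul_sum, Finset.mul_sum, ← Finset.sum_add_distrib]
  -- A point lying in `r ≥ 1` of the sets contributes `2 * r ≤ 2 + r * (r - 1)`, that is `0 ≤ (r -
  -- 1) * (r - 2)`.
  refine Finset.sum_le_sum fun x _ => ?_
  rcases Nat.eq_zero_or_pos (Finset.univ.filter (x ∈ S ·)).card with h0 | h0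
  · simp [h0]
  · have hx : x ∈ ⋃ i, S i := by
      obtain ⟨i, hi⟩ := Finset.card_pos.1 h0
      exact Set.mem_iUnion.2 ⟨i, (Finset.mem_filter.1 hi).2⟩
    rw [Set.indicator_of_mem hx, Pi.one_apply]
    obtain ⟨c, hc⟩ := Nat.exists_eq_add_of_le' h0
    rw [hc, Nat.add_sub_cancel]
    nlinarith [Nat.le_mul_self c]

theorem ncard_mmClass (n : ℕ) : (mmClass n).ncard = (2 ^ n).factorial * 2 ^ 2 ^ n := by
  classical
  have hinj : Function.Injective fun p : Equiv.Perm (BVec n) × (BVec n → ZMod 2) =>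
      mmFun p.1 p.2 := by
    rintro ⟨π, φ⟩ ⟨π', φ'⟩ h
    have hval (x y : BVec n) : x ⬝ᵥ π y + φ y = x ⬝ᵥ π' y + φ' y := congrFun h (x, y)
    have hφ : φ = φ' := funext fun y => by simpa using hval 0 y
    subst hφ
    have hπ : π = π' := Equiv.ext fun y =>
      dotProduct_eq_iff_forall.1 fun x => add_right_cancel (hval x y)
    rw [hπ]
  have hrange : mmClass n = Set.range fun p : Equiv.Perm (BVec n) × (BVec n → ZMod 2) =>
      mmFun p.1 p.2 := by
    ext f
    simp [mmClass, eq_comm]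
  rw [hrange, ← Set.image_univ, Set.ncard_image_of_injective _ hinj, Set.ncard_univ, Nat.card_prod,
    Nat.card_perm, Nat.card_fun (α := BVec n)]
  simp

open Module in
theorem ncard_completedMMClass_bounds (n : ℕ) :
    gaussBinom (2 * n) n * ((mmClass n).ncard : ℚ) - gaussBinom (2 * n) n * mmBound n / 2
        ≤ ((completedMMClass n).ncard : ℚ) ∧
      ((completedMMClass n).ncard : ℚ) ≤ gaussBinom (2 * n) n * ((mmClass n).ncard : ℚ) := by
  classical
  have := Fintype.ofFinite
    {U : Submodule (ZMod 2) (BVec n × BVec n) // finrank (ZMod 2) U = n}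
  have hfin : finrank (ZMod 2) (BVec n × BVec n) = 2 * n := by simp; omega
  have hN := card_submodule_finrank_eq (E := BVec n × BVec n) (k := n) (by omega)
  rw [hfin, Nat.card_eq_fintype_card] at hN
  have hsum : ∑ U : {U : Submodule (ZMod 2) (BVec n × BVec n) // finrank (ZMod 2) U = n},
      (affBent U.1).ncard = Fintype.card
        {U : Submodule (ZMod 2) (BVec n × BVec n) // finrank (ZMod 2) U = n} *
          (mmClass n).ncard := by
    rw [Finset.sum_congr rfl fun U _ => ncard_affBent U.2]
    simp
  rw [completedMMClass_eq_iUnion, ← hN]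
  constructor
  · have h := two_mul_sum_ncard_le fun U :
      {U : Submodule (ZMod 2) (BVec n × BVec n) // finrank (ZMod 2) U = n} => affBent U.1
    rw [hsum] at h
    have h' := (Nat.cast_le (α := ℚ)).2 h
    push_cast at h'
    have h2 := Finset.sum_le_card_nsmul Finset.univ _ (mmBound n)
      fun U _ => sum_ncard_affBent_inter_le (n := n) U
    rw [nsmul_eq_mul, Finset.card_univ] at h2
    linarith
  · norm_cast
    rw [← hsum]
    exact Set.ncard_iUnion_le_of_fintype _

theorem mmBound_nonneg (n : ℕ) : 0 ≤ mmBound n := by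
  refine Finset.sum_nonneg fun k _ => ?_
  have : 0 ≤ ∏ i ∈ Finset.range (n - k), ((2 : ℚ) ^ (n - k) - 2 ^ i) ^ (2 ^ k) :=
    Finset.prod_nonneg fun i hi => pow_nonneg (sub_nonneg.2
      (pow_le_pow_right₀ one_le_two (Finset.mem_range.1 hi).le)) _
  positivity

/-! ### Numerical values for `n = 4`. -/

theorem gaussBinom_eight_four : gaussBinom 8 4 = 200787 := by
  norm_num [gaussBinom, Finset.prod_range_succ]

theorem mmBound_four : mmBound 4 = 1050876491857920 := by
  norm_num [mmBound, gaussBinom, Finset.prod_range_succ, Finset.sum_range_succ, Nat.factorial]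

theorem gaussBinom_two_mul_nonneg (n : ℕ) : 0 ≤ gaussBinom (2 * n) n :=
  Finset.prod_nonneg fun i hi => div_nonneg
    (sub_nonneg.2 (pow_le_pow_right₀ one_le_two (by have := Finset.mem_range.1 hi; omega)))
    (sub_nonneg.2 (pow_le_pow_right₀ one_le_two (Finset.mem_range.1 hi).le))

/-- The subtracted number is `mmBound 4 / 2`. Subtracting all of `mmBound 4` would give a lower
estimate of about `77.8643` for the logarithm, short of the required `77.8645`. -/
theorem ncard_completedMMClass_four_bounds :
    200787 * (1371195958099968000 - 525438245928960) ≤ (completedMMClass 4).ncard ∧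
      (completedMMClass 4).ncard ≤ 200787 * 1371195958099968000 := by
  have h := ncard_completedMMClass_bounds 4
  rw [ncard_mmClass, mmBound_four, show 2 * 4 = 8 from rfl, gaussBinom_eight_four,
    show Nat.factorial (2 ^ 4) * 2 ^ 2 ^ 4 = 1371195958099968000 by decide] at h
  constructor
  · have := h.1
    rw [← Nat.cast_le (α := ℚ)]
    norm_num at this ⊢
    linarith
  · have := h.2
    rw [← Nat.cast_le (α := ℚ)]
    norm_num at this ⊢
    linarith

set_option exponentiation.threshold 20000 in
theorem mainTheorem5 :
    (∀ n : ℕ,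
      gaussBinom (2 * n) n * ((mmClass n).ncard : ℚ) - gaussBinom (2 * n) n * mmBound n
          ≤ ((completedMMClass n).ncard : ℚ) ∧
        ((completedMMClass n).ncard : ℚ)
          ≤ gaussBinom (2 * n) n * ((mmClass n).ncard : ℚ)) ∧
    |Real.logb 2 ((completedMMClass 4).ncard : ℝ) - 77.865| < 0.0005 := by
  constructor
  · intro n
    have h := ncard_completedMMClass_bounds n
    have := mul_nonneg (gaussBinom_two_mul_nonneg n) (mmBound_nonneg n)
    exact ⟨by linarith, h.2⟩
  · obtain ⟨h1, h2⟩ := ncard_completedMMClass_four_bounds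
    set c := (completedMMClass 4).ncard
    have hc : (0 : ℝ) < c := by
      have : 0 < c := lt_of_lt_of_le (by norm_num) h1
      exact_mod_cast this
    -- `2881 / 37 ≈ 77.86486` lies between `77.8645` and the logarithm of the lower bound; its small
    -- denominator reduces the claim to comparing integer powers.
    have hlow : (2881 : ℝ) ≤ 37 * Real.logb 2 c := by
      rw [← Nat.cast_ofNat (n := 37), ← Real.logb_pow, Real.le_logb_iff_rpow_le one_lt_two
        (by positivity),
        show (2881 : ℝ) = ((2881 : ℕ) : ℝ) by norm_num, Real.rpow_natCast]
      have : 2 ^ 2881 ≤ c ^ 37 := le_trans (by norm_num) (Nat.pow_le_pow_left h1 37)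
      exact_mod_cast this
    -- Likewise `13315 / 171 ≈ 77.865497` lies between the logarithm of the upper bound and
    -- `77.8655`.
    have hupp : 171 * Real.logb 2 c ≤ (13315 : ℝ) := by
      rw [← Nat.cast_ofNat (n := 171), ← Real.logb_pow, Real.logb_le_iff_le_rpow one_lt_two
        (by positivity),
        show (13315 : ℝ) = ((13315 : ℕ) : ℝ) by norm_num, Real.rpow_natCast]
      have : c ^ 171 ≤ 2 ^ 13315 := le_trans (Nat.pow_le_pow_left h2 171) (by norm_num)
      exact_mod_cast this
    rw [abs_lt]
    constructor <;> norm_num <;> linarith
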